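/- Let $N\ge 2$ be an integer, let $\alpha,\beta,\gamma\in\{1,\dots,N\}$ with $\beta\le\alpha$, and write $q^z:=e^{2\pi i z/N}$ for $z\in\mathbb C$. Let $D$ be the shift operator $(D\Psi)(x)=\Psi(x+1)$ on meromorphic functions on $\mathbb C$, and consider the $q$-hypergeometric difference equation $$L\Psi=0,\qquad L:=(1-D)(1-q^{\gamma-1}D)-q^{x}(1-q^{\alpha}D)(1-q^{\beta}D).$$ Let $\mathcal C$ be the field of meromorphic functions on $\mathbb C$ of period $1$ (the quasi-constants), and let $\mathcal S$ be the $\mathcal C$-vector space of all functions $\sum_{j=0}^{n}\sum_{k=0}^{N-1}f_{jk}\,x^{j}q^{kx}$ with $n\ge 0$ and $f_{jk}\in\mathcal C$. Put $$a_k:=(1-q^{k})(1-q^{\gamma-1+k}),\qquad b_k:=(1-q^{\alpha+k})(1-q^{\beta+k}),\qquad e_j:=\frac{1-q^{\gamma+2j-1}}{a_j}-\frac{1-q^{\alpha+\beta+2(j-1)}}{b_{j-1}}.$$ Empty products are $1$, empty sums are $0$, and a term with the factor $1-q^{\beta-\alpha}$ is $0$ when $\alpha=\beta$. **Theorem.**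 The space $\{\Psi\in\mathcal S: L\Psi=0\}$ is two-dimensional over $\mathcal C$. Only the powers $x^0$ and $x^1$ occur in its elements: if $\sum_{j=0}^{n}\sum_{k=0}^{N-1}f_{jk}x^jq^{kx}$ with $f_{jk}\in\mathcal C$ is a solution, then $f_{jk}=0$ for all $j\ge 2$ and all $k$. A basis $\{\Psi_1,\Psi_2\}$ of this space over $\mathcal C$ is given as follows. 1. If $\gamma\le\beta\le\alpha$: $$\Psi_1(x)=\sum_{k=0}^{N-\alpha}\frac{b_0\cdots b_{k-1}}{a_1\cdots a_k}q^{kx},$$ $$\begin{aligned}\Psi_2(x)={}&x\Psi_1(x)+\sum_{k=1}^{N-\alpha}\frac{b_0\cdots b_{k-1}}{a_1\cdots a_k}\Big(\sum_{j=1}^{k}e_j\Big)q^{kx}\\&-(1-q^{\beta-\alpha})\frac{b_0\cdots b_{N-\alpha-1}}{a_1\cdots a_{N-\alpha+1}}\sum_{k=N-\alpha+1}^{N-\beta}\frac{b_{N-\alpha+1}\cdots b_{k-1}}{a_{N-\alpha+2}\cdots a_k}q^{kx}\\&-(1-q^{\gamma-1})\sum_{k=N-\gamma+1}^{N-1}\frac{a_{k+1}\cdots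 a_{N-1}}{b_k\cdots b_{N-1}\,q^{Nx}}q^{kx}.\end{aligned}$$ 2. If $\beta<\gamma\le\alpha$: $$\Psi_1(x)=\sum_{k=0}^{N-\alpha}\frac{b_0\cdots b_{k-1}}{a_1\cdots a_k}q^{kx},\qquad \Psi_2(x)=\sum_{k=N-\gamma+1}^{N-\beta}\frac{b_{N-\gamma+1}\cdots b_{k-1}}{a_{N-\gamma+2}\cdots a_k}q^{kx}.$$ 3. If $\beta\le\alpha<\gamma$: $$\Psi_1(x)=\sum_{k=N-\gamma+1}^{N-\alpha}\frac{b_{N-\gamma+1}\cdots b_{k-1}}{a_{N-\gamma+2}\cdots a_k}q^{kx},$$ $$\begin{aligned}\Psi_2(x)={}&x\Psi_1(x)-(1-q^{N-\gamma+1})\sum_{k=0}^{N-\gamma}\frac{a_{k+1}\cdots a_{N-\gamma}}{b_k\cdots b_{N-\gamma}}q^{kx}\\&+\sum_{k=N-\gamma+2}^{N-\alpha}\frac{b_{N-\gamma+1}\cdots b_{k-1}}{a_{N-\gamma+2}\cdots a_k}\Big(\sum_{j=N-\gamma+2}^{k}e_j\Big)q^{kx}\\&-(1-q^{\beta-\alpha})\frac{b_{N-\gamma+1}\cdots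 b_{N-\alpha-1}}{a_{N-\gamma+2}\cdots a_{N-\alpha+1}}\sum_{k=N-\alpha+1}^{N-\beta}\frac{b_{N-\alpha+1}\cdots b_{k-1}}{a_{N-\alpha+2}\cdots a_k}q^{kx}.\end{aligned}$$ -/

import Mathlib

open Filter Topology

noncomputable section

namespace QHyp

/-! ### Meromorphic functions on the complex plane

A meromorphic function is a germ along `codiscrete ℂ` of an everywhere meromorphic function
`ℂ → ℂ`: two functions define the same element when they agree off a closed discrete set,
so that the values assigned at poles do not matter. -/

/-- The ring of meromorphic functions on `ℂ`. -/
def Mero : Subring (Germ (codiscrete ℂ) ℂ) where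
  carrier := {g | ∃ f : ℂ → ℂ, Meromorphic f ∧ (f : Germ (codiscrete ℂ) ℂ) = g}
  mul_mem' := by
    rintro _ _ ⟨f, hf, rfl⟩ ⟨g, hg, rfl⟩
    exact ⟨f * g, hf.mul hg, rfl⟩
  one_mem' := ⟨1, .const 1, rfl⟩
  add_mem' := by
    rintro _ _ ⟨f, hf, rfl⟩ ⟨g, hg, rfl⟩
    exact ⟨f + g, hf.add hg, rfl⟩
  zero_mem' := ⟨0, .const 0, rfl⟩
  neg_mem' := by
    rintro _ ⟨f, hf, rfl⟩
    exact ⟨-f, hf.neg, rfl⟩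

/-- The element of `Mero` given by a meromorphic function `f : ℂ → ℂ`. -/
def Mero.mk (f : ℂ → ℂ) (hf : Meromorphic f) : Mero := ⟨(f : Germ (codiscrete ℂ) ℂ), f, hf, rfl⟩

/-- A meromorphic function is either zero or nonvanishing off a closed discrete set. -/
theorem eq_zero_or_ne_zero {f : ℂ → ℂ} (hf : Meromorphic f) :
    (f =ᶠ[codiscrete ℂ] 0) ∨ ∀ᶠ x in codiscrete ℂ, f x ≠ 0 := by
  by_cases h : ∃ u, meromorphicOrderAt f u ≠ ⊤
  · right
    have h' := hf.exists_meromorphicOrderAt_ne_top_iff_forall.1 h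
    exact (meromorphicOn_univ.2 hf).eventually_codiscreteWithin_apply_ne_zero fun x _ => h' x
  · left
    push Not at h
    change {x | f x = 0} ∈ codiscrete ℂ
    rw [mem_codiscrete]
    intro x
    rw [disjoint_principal_right, compl_compl]
    exact meromorphicOrderAt_eq_top_iff.1 (h x)

instance : Inv Mero where
  inv g := ⟨(g : Germ (codiscrete ℂ) ℂ)⁻¹, by
    obtain ⟨f, hf, h⟩ := g.2
    exact ⟨f⁻¹, hf.inv, by rw [← h]; rfl⟩⟩

instance : NeBot (codiscrete ℂ) := by
  refine ⟨fun h => ?_⟩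
  have := mem_codiscrete.1 (empty_mem_iff_bot.2 h) (0 : ℂ)
  rw [disjoint_principal_right, compl_compl, empty_mem_iff_bot] at this
  exact NeBot.ne inferInstance this

/-- Meromorphic functions on `ℂ` form a field. -/
instance : Field Mero where
  toCommRing := inferInstance
  inv := Inv.inv
  exists_pair_ne := ⟨0, 1, fun h => zero_ne_one (congrArg Subtype.val h)⟩
  mul_inv_cancel := by
    rintro ⟨_, f, hf, rfl⟩ h0
    apply Subtype.ext
    change ((f * f⁻¹ : ℂ → ℂ) : Germ (codiscrete ℂ) ℂ) = ((1 : ℂ → ℂ) : Germ (codiscrete ℂ) ℂ)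
    rcases eq_zero_or_ne_zero hf with h | h
    · exact absurd (Subtype.ext (Germ.coe_eq.2 h)) h0
    · refine Germ.coe_eq.2 ?_
      filter_upwards [h] with x hx
      simp [hx]
  inv_zero := by
    apply Subtype.ext
    change (((0 : ℂ → ℂ)⁻¹ : ℂ → ℂ) : Germ (codiscrete ℂ) ℂ) = ((0 : ℂ → ℂ) : Germ (codiscrete ℂ) ℂ)
    congr 1
    ext x
    simp
  nnqsmul := _
  nnqsmul_def _ _ := rfl
  qsmul := _
  qsmul_def _ _ := rfl

/-! ### The shift operator and the quasi-constants -/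

theorem tendsto_shift : Tendsto (fun x : ℂ => x + 1) (codiscrete ℂ) (codiscrete ℂ) := by
  intro s hs
  rw [mem_map, mem_codiscrete]
  intro x
  have h := mem_codiscrete.1 hs (x + 1)
  rw [disjoint_principal_right, compl_compl] at h ⊢
  have ht : Tendsto (fun x : ℂ => x + 1) (𝓝[≠] x) (𝓝[≠] (x + 1)) :=
    ((continuous_id.add continuous_const).continuousWithinAt).tendsto_nhdsWithin
      fun y hy => by simpa using hy
  exact ht h

theorem meromorphic_shift {f : ℂ → ℂ} (hf : Meromorphic f) :
    Meromorphic (fun x : ℂ => f (x + 1)) := by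
  intro x
  have hg : AnalyticAt ℂ (fun x : ℂ => x + 1) x := by fun_prop
  exact MeromorphicAt.comp_analyticAt (f := f) (g := fun x => x + 1) (hf (x + 1)) hg

/-- The shift `(D Ψ)(x) = Ψ(x + 1)`, as a ring endomorphism of the meromorphic functions. -/
def shift : Mero →+* Mero where
  toFun g := ⟨(g : Germ (codiscrete ℂ) ℂ).compTendsto _ tendsto_shift, by
    obtain ⟨f, hf, h⟩ := g.2
    exact ⟨fun x => f (x + 1), meromorphic_shift hf, by rw [← h]; rfl⟩⟩
  map_one' := rfl
  map_zero' := rfl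
  map_mul' := by
    rintro ⟨_, f, hf, rfl⟩ ⟨_, g, hg, rfl⟩
    rfl
  map_add' := by
    rintro ⟨_, f, hf, rfl⟩ ⟨_, g, hg, rfl⟩
    rfl

/-- The field of quasi-constants: meromorphic functions of period `1`. -/
def QC : Subfield Mero := shift.eqLocusField (RingHom.id Mero)

/-- The shift operator `D`, which is linear over the quasi-constants. -/
def D : Module.End QC Mero where
  toFun := shift
  map_add' := map_add shift
  map_smul' c g := by
    have hc : shift (c : Mero) = (c : Mero) := c.2
    change shift ((c : Mero) * g) = (c : Mero) * shift g
    rw [map_mul, hc]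

/-! ### The equation and the space `S` -/

/-- `q ^ z` for `q = exp (2 π i / N)`, that is `exp (2 π i z / N)`. -/
def qpow (N : ℕ) (z : ℂ) : ℂ := Complex.exp (2 * Real.pi * Complex.I / N * z)

/-- A constant as a meromorphic function. -/
def const (c : ℂ) : Mero := Mero.mk (fun _ => c) (.const c)

/-- The meromorphic function `x`. -/
def X : Mero := Mero.mk (fun x => x) fun _ => by fun_prop

/-- The meromorphic function `q ^ (k x)`. -/
def qX (N : ℕ) (k : ℕ) : Mero := Mero.mk (fun x => qpow N (k * x)) fun x => by
  have h : AnalyticAt ℂ (fun x : ℂ => qpow N (k * x)) x := by unfold qpow; fun_prop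
  exact h.meromorphicAt

/-- Multiplication by a meromorphic function, as an operator. -/
def mulBy (g : Mero) : Module.End QC Mero := LinearMap.mulLeft QC g

/-- The `q`-hypergeometric difference operator
`L = (1 - D)(1 - q^(γ-1) D) - q^x (1 - q^α D)(1 - q^β D)`. -/
def L (N α β γ : ℕ) : Module.End QC Mero :=
  (1 - D) * (1 - mulBy (const (qpow N (γ - 1))) * D)
    - mulBy (qX N 1) *
      ((1 - mulBy (const (qpow N α)) * D) * (1 - mulBy (const (qpow N β)) * D))

/-- The space `S` of all finite sums `∑ f_{jk} x^j q^(k x)` with `j ≥ 0`, `0 ≤ k ≤ N - 1` and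
quasi-constants `f_{jk}`. -/
def S (N : ℕ) : Submodule QC Mero :=
  Submodule.span QC (Set.range fun p : ℕ × Fin N => X ^ p.1 * qX N p.2)

/-- The space of solutions of `L Ψ = 0` in `S`. -/
def Sol (N α β γ : ℕ) : Submodule QC Mero := S N ⊓ LinearMap.ker (L N α β γ)

/-! ### The explicit solutions -/

/-- `a_k = (1 - q^k)(1 - q^(γ-1+k))`. -/
def a (N γ : ℕ) (k : ℕ) : ℂ := (1 - qpow N k) * (1 - qpow N (γ - 1 + k))

/-- `b_k = (1 - q^(α+k))(1 - q^(β+k))`. -/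
def b (N α β : ℕ) (k : ℕ) : ℂ := (1 - qpow N (α + k)) * (1 - qpow N (β + k))

/-- The quotient `b_m ⋯ b_{k-1} / (a_{m+1} ⋯ a_k)`, equal to `1` for `k = m`. -/
def ratio (N α β γ : ℕ) (m k : ℕ) : ℂ :=
  (∏ i ∈ Finset.Ico m k, b N α β i) / ∏ i ∈ Finset.Icc (m + 1) k, a N γ i

/-- `(1 - q^(γ+2j-1)) / a_j - (1 - q^(α+β+2(j-1))) / b_{j-1}`; only used for `j ≥ 1`. -/
def corr (N α β γ : ℕ) (j : ℕ) : ℂ :=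
  (1 - qpow N (γ + 2 * j - 1)) / a N γ j - (1 - qpow N (α + β + 2 * (j - 1))) / b N α β (j - 1)

/-- `Ψ₁` for `γ ≤ β ≤ α` and for `β < γ ≤ α`. -/
def psi₁ (N α β γ : ℕ) (x : ℂ) : ℂ :=
  ∑ k ∈ Finset.Icc 0 (N - α), ratio N α β γ 0 k * qpow N (k * x)

/-- `Ψ₂` for `γ ≤ β ≤ α`. -/
def psi₂A (N α β γ : ℕ) (x : ℂ) : ℂ :=
  x * psi₁ N α β γ x
    + ∑ k ∈ Finset.Icc 1 (N - α),
        ratio N α β γ 0 k * (∑ j ∈ Finset.Icc 1 k, corr N α β γ j) * qpow N (k * x)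
    - (1 - qpow N (β - α)) *
        ((∏ i ∈ Finset.Ico 0 (N - α), b N α β i) / ∏ i ∈ Finset.Icc 1 (N - α + 1), a N γ i) *
        ∑ k ∈ Finset.Icc (N - α + 1) (N - β), ratio N α β γ (N - α + 1) k * qpow N (k * x)
    - (1 - qpow N (γ - 1)) *
        ∑ k ∈ Finset.Icc (N - γ + 1) (N - 1),
          (∏ i ∈ Finset.Icc (k + 1) (N - 1), a N γ i) /
            ((∏ i ∈ Finset.Icc k (N - 1), b N α β i) * qpow N (N * x)) * qpow N (k * x)

/-- `Ψ₂` for `β < γ ≤ α`. -/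
def psi₂B (N α β γ : ℕ) (x : ℂ) : ℂ :=
  ∑ k ∈ Finset.Icc (N - γ + 1) (N - β), ratio N α β γ (N - γ + 1) k * qpow N (k * x)

/-- `Ψ₁` for `β ≤ α < γ`. -/
def psi₁C (N α β γ : ℕ) (x : ℂ) : ℂ :=
  ∑ k ∈ Finset.Icc (N - γ + 1) (N - α), ratio N α β γ (N - γ + 1) k * qpow N (k * x)

/-- `Ψ₂` for `β ≤ α < γ`. -/
def psi₂C (N α β γ : ℕ) (x : ℂ) : ℂ :=
  x * psi₁C N α β γ x
    - (1 - qpow N (N - γ + 1)) *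
        ∑ k ∈ Finset.Icc 0 (N - γ),
          (∏ i ∈ Finset.Icc (k + 1) (N - γ), a N γ i) /
            (∏ i ∈ Finset.Icc k (N - γ), b N α β i) * qpow N (k * x)
    + ∑ k ∈ Finset.Icc (N - γ + 2) (N - α),
        ratio N α β γ (N - γ + 1) k *
          (∑ j ∈ Finset.Icc (N - γ + 2) k, corr N α β γ j) * qpow N (k * x)
    - (1 - qpow N (β - α)) *
        ((∏ i ∈ Finset.Ico (N - γ + 1) (N - α), b N α β i) /
          ∏ i ∈ Finset.Icc (N - γ + 2) (N - α + 1), a N γ i) *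
        ∑ k ∈ Finset.Icc (N - α + 1) (N - β), ratio N α β γ (N - α + 1) k * qpow N (k * x)

/-- The meromorphic functions represented by `Ψ₁, Ψ₂ : ℂ → ℂ` form a basis of the space of
solutions over the field of quasi-constants. -/
def IsSolBasis (N α β γ : ℕ) (Ψ₁ Ψ₂ : ℂ → ℂ) : Prop :=
  ∃ B : Module.Basis (Fin 2) QC (Sol N α β γ),
    ((B 0 : Mero) : Germ (codiscrete ℂ) ℂ) = Ψ₁ ∧ ((B 1 : Mero) : Germ (codiscrete ℂ) ℂ) = Ψ₂

end QHyp

end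

/-!
The operator `L` has order two in the shift, so by the Casoratian argument two solutions that are
independent over the quasi-constants span the whole kernel of `L`, among all meromorphic functions
(`mem_span_pair_of_recurrence`). It remains to check that the given functions are independent
solutions; the dimension is then `2`, and no `x ^ j` with `j ≥ 2` occurs in a solution because none
occurs in the basis.

Coefficients may be compared because the functions `x ^ j q ^ (k x)` with `0 ≤ k < N` are
independent over the quasi-constants (`eq_zero_of_sum_X_pow_mul_qX_eq_zero`): they are generalized
eigenvectors of the shift for the distinct eigenvalues `q ^ k`, and `x` is transcendental over the
quasi-constants.

On `(u + v x) q ^ (k x)` with quasi-constants `u`, `v`, the operator `L` acts by the numbers `a k`,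
`b k` and by `a k - (1 - q ^ (γ + 2 k - 1))`, `b k - (1 - q ^ (α + β + 2 k))`, the coefficients of
`v` without `x`. Hence a function `∑ (u k + v k x) q ^ (k x)` is a solution if its coefficients
satisfy a first-order recurrence in `k`, which is closed up cyclically by the quasi-constant
`q ^ (N x)` (`L_comb_eq_zero`). The explicit solutions are those found by running this recurrence
between the zeros of `a` (at `0` and `N - γ + 1`) and of `b` (at `N - α` and `N - β`).
-/

noncomputable section

namespace QHyp

/-! ### The powers of `q` -/

theorem qpow_add (N : ℕ) (z w : ℂ) : qpow N (z + w) = qpow N z * qpow N w := by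
  simp only [qpow, mul_add, Complex.exp_add]

theorem qpow_ne_zero (N : ℕ) (z : ℂ) : qpow N z ≠ 0 := Complex.exp_ne_zero _

@[simp]
theorem qpow_zero (N : ℕ) : qpow N 0 = 1 := by simp [qpow]

theorem qpow_self {N : ℕ} (hN : N ≠ 0) : qpow N N = 1 := by
  have : (N : ℂ) ≠ 0 := by exact_mod_cast hN
  rw [qpow, div_mul_cancel₀ _ this, Complex.exp_two_pi_mul_I]

theorem qpow_intCast_eq_one_iff {N : ℕ} (hN : N ≠ 0) (m : ℤ) :
    qpow N m = 1 ↔ (N : ℤ) ∣ m := by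
  have h : (N : ℂ) ≠ 0 := by exact_mod_cast hN
  rw [qpow, Complex.exp_eq_one_iff]
  have hpi := Complex.two_pi_I_ne_zero
  refine exists_congr fun n => ⟨fun e => ?_, fun e => ?_⟩
  · have e' : (m : ℂ) = N * n := by
      field_simp at e
      exact e
    exact_mod_cast e'
  · rw [e]
    push_cast
    field_simp

/-! ### Constants, quasi-constants and the shift -/

/-- The constants form a subfield of the meromorphic functions. -/
def constHom : ℂ →+* Mero where
  toFun := const
  map_one' := rfl
  map_zero' := rfl
  map_mul' _ _ := rfl
  map_add' _ _ := rfl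

@[simp] theorem const_zero : const 0 = 0 := rfl
@[simp] theorem const_one : const 1 = 1 := rfl
theorem const_mul (c d : ℂ) : const (c * d) = const c * const d := rfl
theorem const_add (c d : ℂ) : const (c + d) = const c + const d := rfl
theorem const_sub (c d : ℂ) : const (c - d) = const c - const d := rfl

theorem const_injective : Function.Injective const := constHom.injective

instance : CharZero Mero := charZero_of_injective_ringHom constHom.injective

theorem shift_const (c : ℂ) : shift (const c) = const c := rfl

theorem shift_X : shift X = X + 1 := rfl

theorem shift_qX (N k : ℕ) : shift (qX N k) = const (qpow N k) * qX N k := by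
  apply Subtype.ext
  refine congrArg (fun f : ℂ → ℂ => (f : Germ (codiscrete ℂ) ℂ)) (funext fun x => ?_)
  change qpow N (k * (x + 1)) = qpow N k * qpow N (k * x)
  rw [← qpow_add]
  congr 1
  ring

theorem qX_add (N k l : ℕ) : qX N (k + l) = qX N k * qX N l := by
  apply Subtype.ext
  refine congrArg (fun f : ℂ → ℂ => (f : Germ (codiscrete ℂ) ℂ)) (funext fun x => ?_)
  change qpow N ((k + l : ℕ) * x) = qpow N (k * x) * qpow N (l * x)
  rw [← qpow_add]
  congr 1
  push_cast
  ring

@[simp]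
theorem qX_zero (N : ℕ) : qX N 0 = 1 := by
  apply Subtype.ext
  refine congrArg (fun f : ℂ → ℂ => (f : Germ (codiscrete ℂ) ℂ)) (funext fun x => ?_)
  simp

theorem qX_ne_zero (N k : ℕ) : qX N k ≠ 0 := by
  intro h
  have h' : ((fun x => qpow N (k * x) : ℂ → ℂ) : Germ (codiscrete ℂ) ℂ) = ((0 : ℂ → ℂ) : _) :=
    congrArg Subtype.val h
  obtain ⟨x, hx⟩ := (Germ.coe_eq.1 h').exists
  exact qpow_ne_zero N _ hx

theorem mem_QC {g : Mero} : g ∈ QC ↔ shift g = g := Iff.rfl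

theorem const_mem_QC (c : ℂ) : const c ∈ QC := shift_const c

theorem qX_self_mem_QC {N : ℕ} (hN : N ≠ 0) : qX N N ∈ QC := by
  rw [mem_QC, shift_qX, qpow_self hN, const_one, one_mul]

theorem QC.smul_def (c : QC) (g : Mero) : c • g = (c : Mero) * g := rfl

/-! ### Linear independence of the functions `x ^ j q ^ (k x)` -/

/-- `x` is transcendental over the quasi-constants: with `x`, all its translates `x + n` would be
roots of the same polynomial. -/
theorem transcendental_X : Transcendental QC X := by
  rintro ⟨p, hp, hX⟩
  have key : ∀ n : ℕ, Polynomial.aeval (X + n : Mero) p = 0 := by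
    intro n
    induction n with
    | zero => simpa using hX
    | succ n ih =>
      have h := congrArg shift ih
      rw [map_zero, Polynomial.aeval_eq_sum_range, map_sum] at h
      rw [Polynomial.aeval_eq_sum_range, ← h]
      refine Finset.sum_congr rfl fun i _ => ?_
      have hc : shift (p.coeff i : Mero) = p.coeff i := (p.coeff i).2
      rw [QC.smul_def, QC.smul_def, map_mul, map_pow, map_add, shift_X, map_natCast, hc]
      push_cast
      ring
  have hinf : Set.Infinite (Set.range fun n : ℕ => (X + n : Mero)) :=
    Set.infinite_range_of_injective fun m n h => by simpa using h
  refine hinf ((p.rootSet_finite Mero).subset ?_)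
  rintro _ ⟨n, rfl⟩
  exact (Polynomial.mem_rootSet.2 ⟨hp, key n⟩)

/-- The eigenvalue `q ^ k` of `D`, as a quasi-constant. -/
def eigenval (N k : ℕ) : QC := ⟨const (qpow N k), const_mem_QC _⟩

theorem eigenval_injective {N : ℕ} :
    Function.Injective fun k : Fin N => eigenval N k := by
  intro k l h
  have hN : N ≠ 0 := by have := k.2; omega
  have h1 : qpow N (k : ℕ) = qpow N (l : ℕ) := const_injective (congrArg Subtype.val h)
  have h2 : qpow N (((k : ℕ) : ℤ) - ((l : ℕ) : ℤ) : ℤ) = 1 := by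
    have := qpow_add N ((k : ℕ) - (l : ℕ) : ℂ) (l : ℕ)
    rw [sub_add_cancel, h1] at this
    push_cast
    exact (mul_eq_right₀ (qpow_ne_zero N _)).1 this.symm
  have h3 := (qpow_intCast_eq_one_iff hN _).1 h2
  have := Int.eq_zero_of_abs_lt_dvd h3 (by rw [abs_lt]; constructor <;> omega)
  exact Fin.ext (by omega)

theorem X_pow_mul_qX_mem_maxGenEigenspace (N k j : ℕ) :
    X ^ j * qX N k ∈ D.maxGenEigenspace (eigenval N k) := by
  induction j using Nat.strong_induction_on with
  | _ j ih =>
    have h : (D - eigenval N k • 1) (X ^ j * qX N k) ∈ D.maxGenEigenspace (eigenval N k) := by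
      have e : (D - eigenval N k • 1) (X ^ j * qX N k) = eigenval N k •
          ∑ i ∈ Finset.range j, (j.choose i : QC) • (X ^ i * qX N k) := by
        have hx : (X + 1 : Mero) ^ j =
            (∑ i ∈ Finset.range j, (j.choose i : Mero) * X ^ i) + X ^ j := by
          rw [add_pow, Finset.sum_range_succ]
          simp [mul_comm]
        have hs : ∑ i ∈ Finset.range j, (j.choose i : QC) • (X ^ i * qX N k) =
            (∑ i ∈ Finset.range j, (j.choose i : Mero) * X ^ i) * qX N k := by
          rw [Finset.sum_mul]
          refine Finset.sum_congr rfl fun i _ => ?_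
          rw [QC.smul_def, mul_assoc]
          rfl
        rw [hs, QC.smul_def]
        change shift (X ^ j * qX N k) - const (qpow N k) * (X ^ j * qX N k) =
          const (qpow N k) * _
        rw [map_mul, map_pow, shift_X, shift_qX, hx]
        ring
      rw [e]
      exact Submodule.smul_mem _ _ (Submodule.sum_mem _ fun i hi =>
        Submodule.smul_mem _ _ (ih i (Finset.mem_range.1 hi)))
    rw [Module.End.mem_maxGenEigenspace] at h ⊢
    obtain ⟨m, hm⟩ := h
    exact ⟨m + 1, by rw [pow_succ]; exact hm⟩

/-- For distinct `k` the functions `x ^ j q ^ (k x)` lie in different generalized eigenspaces of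
`D`, and for one `k` they are independent since `x` is transcendental. -/
theorem eq_zero_of_sum_X_pow_mul_qX_eq_zero {N n : ℕ} {f : ℕ → Fin N → QC}
    (h : ∑ j ∈ Finset.range n, ∑ k : Fin N, f j k • (X ^ j * qX N k) = 0)
    {j : ℕ} (hj : j < n) (k : Fin N) : f j k = 0 := by
  have hind := (Module.End.independent_maxGenEigenspace D).comp (eigenval_injective (N := N))
  rw [Finset.sum_comm] at h
  have hk := (iSupIndep_iff_finsetSum_eq_zero_imp_eq_zero _).1 hind Finset.univ
    (fun k : Fin N => ∑ j ∈ Finset.range n, f j k • (X ^ j * qX N k))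
    (fun k _ => Submodule.sum_mem _ fun j _ => Submodule.smul_mem _ _
      (X_pow_mul_qX_mem_maxGenEigenspace N k j)) h k (Finset.mem_univ _)
  have hp : Polynomial.aeval X (∑ j ∈ Finset.range n, Polynomial.monomial j (f j k)) = 0 := by
    apply (mul_eq_zero.1 _).resolve_right (qX_ne_zero N k)
    rw [map_sum, Finset.sum_mul, ← hk]
    refine Finset.sum_congr rfl fun i _ => ?_
    rw [Polynomial.aeval_monomial, QC.smul_def, mul_assoc]
    rfl
  have h0 := transcendental_iff.1 transcendental_X _ hp
  have := congrArg (fun p => Polynomial.coeff p j) h0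
  simpa [Polynomial.coeff_monomial, hj] using this

/-! ### The equation as a three-term recurrence -/

theorem L_apply (N α β γ : ℕ) (g : Mero) :
    L N α β γ g = (1 - qX N 1) * g
      - (1 + const (qpow N (γ - 1)) - qX N 1 * (const (qpow N α) + const (qpow N β))) * shift g
      + (const (qpow N (γ - 1)) - qX N 1 * (const (qpow N α) * const (qpow N β))) *
        shift (shift g) := by
  change (g - const (qpow N (γ - 1)) * shift g) - shift (g - const (qpow N (γ - 1)) * shift g)
    - qX N 1 * ((g - const (qpow N β) * shift g) -
      const (qpow N α) * shift (g - const (qpow N β) * shift g)) = _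
  simp only [map_sub, map_mul, shift_const]
  ring

/-- The leading coefficient is not zero, as `q ^ x` is not constant. -/
theorem leadingCoeff_ne_zero {N : ℕ} (hN : 2 ≤ N) (α β γ : ℕ) :
    const (qpow N (γ - 1)) - qX N 1 * (const (qpow N α) * const (qpow N β)) ≠ 0 := by
  intro h
  have h' := congrArg shift h
  simp only [map_sub, map_mul, shift_const, shift_qX, map_zero] at h'
  have hc : ∀ z, const (qpow N z) ≠ 0 := fun z => by
    rw [← const_zero]
    exact const_injective.ne (qpow_ne_zero N z)
  have h1 : (const (qpow N (1 : ℕ)) - 1) *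
      (qX N 1 * (const (qpow N α) * const (qpow N β))) = 0 := by
    linear_combination h - h'
  have h2 : const (qpow N (1 : ℕ)) - 1 = 0 :=
    (mul_eq_zero.1 h1).resolve_right (mul_ne_zero (qX_ne_zero N 1) (mul_ne_zero (hc _) (hc _)))
  have h3 : qpow N ((1 : ℤ) : ℂ) = 1 := by
    have := const_injective ((sub_eq_zero.1 h2).trans const_one.symm)
    simpa using this
  have := Int.le_of_dvd one_pos ((qpow_intCast_eq_one_iff (by omega) 1).1 h3)
  omega

/-- The Casoratian of two independent functions does not vanish: otherwise their quotient would
be a quasi-constant. -/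
theorem casoratian_ne_zero {f g : Mero} (h : LinearIndependent QC ![f, g]) :
    f * shift g - g * shift f ≠ 0 := by
  intro h0
  have hf : f ≠ 0 := h.ne_zero 0
  have hσ : shift f ≠ 0 := (map_ne_zero shift).2 hf
  have hq : g / f ∈ QC := by
    rw [mem_QC, map_div₀, div_eq_div_iff hσ hf]
    linear_combination h0
  have hs := LinearIndependent.pair_iff.1 h ⟨g / f, hq⟩ (-1) (by
    rw [QC.smul_def, neg_smul, one_smul]
    change g / f * f + -g = 0
    rw [div_mul_cancel₀ _ hf, add_neg_cancel])
  exact one_ne_zero (neg_eq_zero.1 hs.2)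

/-- A second-order equation has at most two solutions independent over the quasi-constants: the
coefficients that express `g` and its shift through `f₁`, `f₂` and their shifts satisfy, by the
equation, the same two linear equations as their own shifts. -/
theorem mem_span_pair_of_recurrence {c₀ c₁ c₂ f₁ f₂ g : Mero} (hc : c₂ ≠ 0)
    (h : LinearIndependent QC ![f₁, f₂])
    (h₁ : c₀ * f₁ - c₁ * shift f₁ + c₂ * shift (shift f₁) = 0)
    (h₂ : c₀ * f₂ - c₁ * shift f₂ + c₂ * shift (shift f₂) = 0)
    (hg : c₀ * g - c₁ * shift g + c₂ * shift (shift g) = 0) :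
    g ∈ Submodule.span QC {f₁, f₂} := by
  have hW := casoratian_ne_zero h
  set W := f₁ * shift f₂ - f₂ * shift f₁ with hWdef
  have hσW : shift W ≠ 0 := (map_ne_zero shift).2 hW
  obtain ⟨u, hu⟩ : ∃ u, u = (g * shift f₂ - f₂ * shift g) / W := ⟨_, rfl⟩
  obtain ⟨v, hv⟩ : ∃ v, v = (f₁ * shift g - g * shift f₁) / W := ⟨_, rfl⟩
  have hu' : u * W = g * shift f₂ - f₂ * shift g := by rw [hu, div_mul_cancel₀ _ hW]
  have hv' : v * W = f₁ * shift g - g * shift f₁ := by rw [hv, div_mul_cancel₀ _ hW]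
  have e₁ : g = u * f₁ + v * f₂ := by
    apply mul_right_cancel₀ hW
    linear_combination (-f₁) * hu' - f₂ * hv' + g * hWdef
  have e₂ : shift g = u * shift f₁ + v * shift f₂ := by
    apply mul_right_cancel₀ hW
    linear_combination (-shift f₁) * hu' - shift f₂ * hv' + shift g * hWdef
  have e₂' : shift g = shift u * shift f₁ + shift v * shift f₂ := by
    conv_lhs => rw [e₁]
    simp only [map_add, map_mul]
  have e₃' : shift (shift g) = shift u * shift (shift f₁) + shift v * shift (shift f₂) := by
    conv_lhs => rw [e₂]
    simp only [map_add, map_mul]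
  have e₃ : shift (shift g) = u * shift (shift f₁) + v * shift (shift f₂) := by
    apply mul_left_cancel₀ hc
    linear_combination hg - u * h₁ - v * h₂ - c₀ * e₁ + c₁ * e₂
  have hσWdef : shift W = shift f₁ * shift (shift f₂) - shift f₂ * shift (shift f₁) := by
    rw [hWdef]
    simp only [map_sub, map_mul]
  have hu₀ : shift u = u := by
    apply mul_right_cancel₀ hσW
    rw [hσWdef]
    linear_combination shift (shift f₂) * (e₂ - e₂') - shift f₂ * (e₃ - e₃')
  have hv₀ : shift v = v := by
    apply mul_right_cancel₀ hσW
    rw [hσWdef]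
    linear_combination shift f₁ * (e₃ - e₃') - shift (shift f₁) * (e₂ - e₂')
  exact Submodule.mem_span_pair.2 ⟨⟨u, hu₀⟩, ⟨v, hv₀⟩, e₁.symm⟩

/-- Two independent solutions form a basis of the space of solutions. -/
theorem exists_basis_of_linearIndependent {N α β γ : ℕ} (hN : 2 ≤ N) {f₁ f₂ : Mero}
    (h₁ : f₁ ∈ Sol N α β γ) (h₂ : f₂ ∈ Sol N α β γ) (h : LinearIndependent QC ![f₁, f₂]) :
    ∃ B : Module.Basis (Fin 2) QC (Sol N α β γ), (B 0 : Mero) = f₁ ∧ (B 1 : Mero) = f₂ := by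
  let w : Fin 2 → Sol N α β γ := ![⟨f₁, h₁⟩, ⟨f₂, h₂⟩]
  have hw : (Sol N α β γ).subtype ∘ w = ![f₁, f₂] := by
    ext i
    fin_cases i <;> rfl
  have hind : LinearIndependent QC w := by
    rw [← hw] at h
    exact h.of_comp
  have hspan : ⊤ ≤ Submodule.span QC (Set.range w) := by
    rintro ⟨g, hg⟩ -
    have hmem := mem_span_pair_of_recurrence (leadingCoeff_ne_zero hN α β γ) h
      ((L_apply N α β γ f₁).symm.trans h₁.2) ((L_apply N α β γ f₂).symm.trans h₂.2)
      ((L_apply N α β γ g).symm.trans hg.2)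
    have hr : ({f₁, f₂} : Set Mero) = (Sol N α β γ).subtype '' Set.range w := by
      rw [← Set.range_comp, hw, Matrix.range_cons, Matrix.range_cons, Matrix.range_empty,
        Set.union_empty, Set.singleton_union]
    rw [hr, ← Submodule.map_span] at hmem
    obtain ⟨y, hy, e⟩ := hmem
    rwa [show y = ⟨g, hg⟩ from Subtype.ext e] at hy
  refine ⟨Module.Basis.mk hind hspan, ?_, ?_⟩ <;> rw [Module.Basis.mk_apply] <;> rfl

/-! ### Functions of degree at most one in `x` -/

/-- The function `∑ (c k + d k q ^ (-N x) + v k x) q ^ (k x)`, summed over `0 ≤ k < N`. Here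
`q ^ (-N x)` is a quasi-constant and `c`, `d`, `v` are numbers. -/
def comb (N : ℕ) (c d v : ℕ → ℂ) : Mero :=
  ∑ k ∈ Finset.range N,
    (const (c k) + const (d k) * (qX N N)⁻¹ + const (v k) * X) * qX N k

theorem coe_comb (N : ℕ) (c d v : ℕ → ℂ) :
    (comb N c d v : Germ (codiscrete ℂ) ℂ) = ((fun x => ∑ k ∈ Finset.range N,
      (c k + d k * (qpow N (N * x))⁻¹ + v k * x) * qpow N (k * x) : ℂ → ℂ) :
        Germ (codiscrete ℂ) ℂ) := by
  have h := map_sum (Germ.coeRingHom (codiscrete ℂ)) (fun k x =>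
    (c k + d k * (qpow N (N * x))⁻¹ + v k * x) * qpow N (k * x) : ℕ → ℂ → ℂ) (Finset.range N)
  have e : (∑ k ∈ Finset.range N, (fun k x =>
      (c k + d k * (qpow N (N * x))⁻¹ + v k * x) * qpow N (k * x) : ℕ → ℂ → ℂ) k) =
      fun x => ∑ k ∈ Finset.range N,
        (c k + d k * (qpow N (N * x))⁻¹ + v k * x) * qpow N (k * x) := by
    ext x
    simp
  rw [e] at h
  refine Eq.trans ?_ h.symm
  rw [comb, AddSubmonoidClass.coe_finsetSum]
  rfl

/-- The coefficient of `x ^ 0 q ^ (k x)` in `comb N c d v`. -/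
def combCoeff {N : ℕ} (hN : N ≠ 0) (c d : ℕ → ℂ) (k : ℕ) : QC :=
  ⟨const (c k) + const (d k) * (qX N N)⁻¹, add_mem (const_mem_QC _)
    (mul_mem (const_mem_QC _) (inv_mem (qX_self_mem_QC hN)))⟩

theorem comb_eq_sum {N : ℕ} (hN : N ≠ 0) (c d v : ℕ → ℂ) :
    comb N c d v = ∑ j ∈ Finset.range 2, ∑ k : Fin N,
      (if j = 0 then combCoeff hN c d k else ⟨const (v k), const_mem_QC _⟩ : QC) •
        (X ^ j * qX N k) := by
  rw [comb, Finset.sum_range, Finset.sum_range_succ, Finset.sum_range_one,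
    ← Finset.sum_add_distrib]
  refine Finset.sum_congr rfl fun k _ => ?_
  simp only [if_true, one_ne_zero, if_false, QC.smul_def, combCoeff]
  ring

theorem comb_mem_S {N : ℕ} (hN : N ≠ 0) (c d v : ℕ → ℂ) : comb N c d v ∈ S N := by
  rw [comb_eq_sum hN]
  exact Submodule.sum_mem _ fun j _ => Submodule.sum_mem _ fun k _ =>
    Submodule.smul_mem _ _ (Submodule.subset_span ⟨(j, k), rfl⟩)

theorem combCoeff_self {N : ℕ} (hN : N ≠ 0) {c d : ℕ → ℂ} {k : ℕ} {z : ℂ} (hc : c k = z)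
    (hd : d k = 0) : combCoeff hN c d k = ⟨const z, const_mem_QC _⟩ := by
  apply Subtype.ext
  simp [combCoeff, hc, hd]

/-- Quasi-constant multiples of two functions of degree at most one in `x` that add up to zero do
so coefficient by coefficient. -/
theorem coeff_eq_zero_of_smul_comb_add {N : ℕ} (hN : N ≠ 0) {c₁ d₁ v₁ c₂ d₂ v₂ : ℕ → ℂ} {s t : QC}
    (h : s • comb N c₁ d₁ v₁ + t • comb N c₂ d₂ v₂ = 0) {k : ℕ} (hk : k < N) :
    s * combCoeff hN c₁ d₁ k + t * combCoeff hN c₂ d₂ k = 0 ∧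
    (s : Mero) * const (v₁ k) + t * const (v₂ k) = 0 := by
  have h' : ∑ j ∈ Finset.range 2, ∑ k : Fin N,
      (if j = 0 then s * combCoeff hN c₁ d₁ k + t * combCoeff hN c₂ d₂ k
        else s * ⟨const (v₁ k), const_mem_QC _⟩ + t * ⟨const (v₂ k), const_mem_QC _⟩ : QC) •
        (X ^ j * qX N k) = 0 := by
    rw [← h, comb_eq_sum hN, comb_eq_sum hN]
    simp only [Finset.smul_sum, ← Finset.sum_add_distrib]
    refine Finset.sum_congr rfl fun j _ => Finset.sum_congr rfl fun k _ => ?_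
    rw [smul_smul, smul_smul, ← add_smul]
    split_ifs <;> rfl
  have e := fun j (hj : j < 2) => eq_zero_of_sum_X_pow_mul_qX_eq_zero h' hj ⟨k, hk⟩
  exact ⟨by simpa using e 0 two_pos, by simpa using congrArg Subtype.val (e 1 one_lt_two)⟩

/-- No power `x ^ j` with `j ≥ 2` occurs in a combination of two functions of degree at most one
in `x`. -/
theorem coeff_eq_zero_of_mem_span_comb {N : ℕ} (hN : N ≠ 0) {c₁ d₁ v₁ c₂ d₂ v₂ : ℕ → ℂ} {n : ℕ}
    {f : ℕ → Fin N → QC} {s t : QC}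
    (h : ∑ j ∈ Finset.range (n + 1), ∑ k : Fin N, f j k • (X ^ j * qX N k) =
      s • comb N c₁ d₁ v₁ + t • comb N c₂ d₂ v₂) {j : ℕ} (hj : 2 ≤ j) (hjn : j ≤ n)
    (k : Fin N) : f j k = 0 := by
  let g : ℕ → Fin N → QC := fun j k => if j < 2 then
    (if j = 0 then s * combCoeff hN c₁ d₁ k + t * combCoeff hN c₂ d₂ k
        else s * ⟨const (v₁ k), const_mem_QC _⟩ + t * ⟨const (v₂ k), const_mem_QC _⟩) else 0
  have hg : ∑ j ∈ Finset.range (n + 1), ∑ k : Fin N, g j k • (X ^ j * qX N k) =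
      s • comb N c₁ d₁ v₁ + t • comb N c₂ d₂ v₂ := by
    rw [← Finset.sum_subset (Finset.range_subset_range.2 (by omega : 2 ≤ n + 1)), comb_eq_sum hN,
      comb_eq_sum hN]
    · simp only [Finset.smul_sum, ← Finset.sum_add_distrib]
      refine Finset.sum_congr rfl fun j hj => Finset.sum_congr rfl fun k _ => ?_
      rw [smul_smul, smul_smul, ← add_smul]
      simp only [g, if_pos (Finset.mem_range.1 hj)]
      split_ifs <;> rfl
    · intro j _ hj
      refine Finset.sum_eq_zero fun k _ => ?_
      simp only [g, if_neg (fun h => hj (Finset.mem_range.2 h)), zero_smul]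
  have h0 : ∑ j ∈ Finset.range (n + 1), ∑ k : Fin N,
      (f j k - g j k) • (X ^ j * qX N k) = 0 := by
    simp only [sub_smul, Finset.sum_sub_distrib]
    rw [h, hg, sub_self]
  have := eq_zero_of_sum_X_pow_mul_qX_eq_zero h0 (by omega : j < n + 1) k
  rwa [show g j k = 0 from if_neg (not_lt.2 hj), sub_zero] at this

/-! ### The recurrence for the coefficients -/

/-- The action of `L` on `(u + v x) q ^ (k x)` with quasi-constants `u`, `v`. -/
theorem L_linear_mul_qX (N α β γ k : ℕ) {u v : Mero} (hu : shift u = u) (hv : shift v = v) :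
    L N α β γ ((u + v * X) * qX N k) =
      (const (a N γ k) * (u + v * X) +
        const (a N γ k - (1 - qpow N (γ + 2 * k - 1))) * v) * qX N k
      - (const (b N α β k) * (u + v * X) +
        const (b N α β k - (1 - qpow N (α + β + 2 * k))) * v) * qX N (k + 1) := by
  have e1 : qpow N (γ + 2 * k - 1) = qpow N (γ - 1) * qpow N k * qpow N k := by
    rw [← qpow_add, ← qpow_add]
    congr 1
    ring
  have e2 : qpow N (α + β + 2 * k) = qpow N α * qpow N β * qpow N k * qpow N k := by
    rw [← qpow_add, ← qpow_add, ← qpow_add]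
    congr 1
    ring
  rw [L_apply, a, b, e1, e2, qX_add]
  simp only [map_add, map_mul, shift_X, shift_qX, hu, hv, shift_const, const_sub, const_mul,
    const_one, qpow_add, map_one]
  ring

/-- The equation for `comb N c d v`, read off coefficient by coefficient. The product
`q ^ ((N - 1) x) q ^ x` is the quasi-constant `q ^ (N x)`, which gives the last three conditions. -/
theorem L_comb_eq_zero {N α β γ : ℕ} (hN : N ≠ 0) {c d v : ℕ → ℂ}
    (hv : ∀ k, k + 1 < N → a N γ (k + 1) * v (k + 1) = b N α β k * v k)
    (hc : ∀ k, k + 1 < N →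
      a N γ (k + 1) * c (k + 1) +
        (a N γ (k + 1) - (1 - qpow N (γ + 2 * (k + 1 : ℕ) - 1))) * v (k + 1) =
      b N α β k * c k + (b N α β k - (1 - qpow N (α + β + 2 * k))) * v k)
    (hd : ∀ k, k + 1 < N → a N γ (k + 1) * d (k + 1) = b N α β k * d k)
    (hv₁ : b N α β (N - 1) * v (N - 1) = 0)
    (hc₀ : -(1 - qpow N (γ - 1)) * v 0 = b N α β (N - 1) * d (N - 1))
    (hc₁ : b N α β (N - 1) * c (N - 1) +
      (b N α β (N - 1) - (1 - qpow N (α + β + 2 * (N - 1 : ℕ)))) * v (N - 1) = 0) :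
    L N α β γ (comb N c d v) = 0 := by
  obtain ⟨M, rfl⟩ := Nat.exists_eq_succ_of_ne_zero hN
  rw [Nat.succ_eq_add_one] at *
  rw [Nat.add_sub_cancel] at hv₁ hc₀ hc₁
  have hw : shift (qX (M + 1) (M + 1))⁻¹ = (qX (M + 1) (M + 1))⁻¹ := inv_mem (qX_self_mem_QC hN)
  have ha0 : a (M + 1) γ 0 = 0 := by simp [a]
  rw [comb, map_sum]
  simp only [fun k => L_linear_mul_qX (M + 1) α β γ k
    (u := const (c k) + const (d k) * (qX (M + 1) (M + 1))⁻¹) (v := const (v k))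
    (by simp only [map_add, map_mul, shift_const, hw]) (shift_const _)]
  rw [Finset.sum_sub_distrib, Finset.sum_range_succ', Finset.sum_range_succ, sub_eq_zero]
  congr 1
  · refine Finset.sum_congr rfl fun k hk => ?_
    have hk' : k + 1 < M + 1 := by simpa using hk
    have h1 := congrArg const (hv k hk')
    have h2 := congrArg const (hc k hk')
    have h3 := congrArg const (hd k hk')
    simp only [const_add, const_mul] at h1 h2 h3
    congr 1
    linear_combination h2 + (qX (M + 1) (M + 1))⁻¹ * h3 + X * h1
  · have h1 := congrArg const hv₁
    have h2 := congrArg const hc₀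
    have h3 := congrArg const hc₁
    simp only [const_add, const_mul, const_zero] at h1 h2 h3
    have hinv : (qX (M + 1) (M + 1))⁻¹ * qX (M + 1) (M + 1) = 1 :=
      inv_mul_cancel₀ (qX_ne_zero _ _)
    have e : qpow (M + 1) (γ + 2 * (0 : ℕ) - 1) = qpow (M + 1) (γ - 1) := by simp
    rw [ha0, e, qX_zero, zero_sub, const_zero]
    linear_combination h2 - const (b (M + 1) α β M) * const (d M) * hinv -
      qX (M + 1) (M + 1) * h3 - X * qX (M + 1) (M + 1) * h1

/-! ### Zeros of the coefficients -/

theorem one_sub_qpow_ne_zero {N : ℕ} (hN : N ≠ 0) {m : ℤ} (hm : ¬ (N : ℤ) ∣ m) {z : ℂ}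
    (hz : z = m) : 1 - qpow N z ≠ 0 := by
  rw [hz]
  exact sub_ne_zero.2 fun h => hm ((qpow_intCast_eq_one_iff hN m).1 h.symm)

theorem one_sub_qpow_eq_zero {N : ℕ} (hN : N ≠ 0) {m : ℤ} (hm : (N : ℤ) ∣ m) {z : ℂ}
    (hz : z = m) : 1 - qpow N z = 0 := by
  rw [hz, (qpow_intCast_eq_one_iff hN m).2 hm, sub_self]

theorem not_dvd_of_pos_of_lt_two_mul {N m : ℤ} (h0 : 0 < m) (h2 : m < 2 * N) (h : m ≠ N) :
    ¬ N ∣ m := by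
  rintro ⟨c, rfl⟩
  have hN : 0 < N := by linarith
  have h1 : 0 < c := pos_of_mul_pos_right h0 hN.le
  have h3 : c < 2 := by nlinarith
  exact h (by rw [show c = 1 by omega, mul_one])

theorem a_ne_zero {N γ i : ℕ} (hγ : 1 ≤ γ) (hγN : γ ≤ N) (h0 : 0 < i) (hi : i < N)
    (h : i ≠ N - γ + 1) : a N γ i ≠ 0 := by
  refine mul_ne_zero (one_sub_qpow_ne_zero (by omega) (m := i)
    (not_dvd_of_pos_of_lt_two_mul ?_ ?_ ?_) (by push_cast; rfl))
    (one_sub_qpow_ne_zero (by omega) (m := γ - 1 + i)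
    (not_dvd_of_pos_of_lt_two_mul ?_ ?_ ?_) (by push_cast; rfl)) <;> omega

theorem a_eq_zero {N γ : ℕ} (hN : N ≠ 0) (hγN : γ ≤ N) : a N γ (N - γ + 1) = 0 := by
  refine mul_eq_zero_of_right _ (one_sub_qpow_eq_zero hN (m := N) dvd_rfl ?_)
  push_cast [Nat.cast_sub hγN]
  ring

theorem b_ne_zero {N α β i : ℕ} (hα : 1 ≤ α) (hαN : α ≤ N) (hβ : 1 ≤ β) (hβN : β ≤ N)
    (hi : i < N) (h₁ : i ≠ N - α) (h₂ : i ≠ N - β) : b N α β i ≠ 0 := by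
  refine mul_ne_zero (one_sub_qpow_ne_zero (by omega) (m := α + i)
    (not_dvd_of_pos_of_lt_two_mul ?_ ?_ ?_) (by push_cast; rfl))
    (one_sub_qpow_ne_zero (by omega) (m := β + i)
    (not_dvd_of_pos_of_lt_two_mul ?_ ?_ ?_) (by push_cast; rfl)) <;> omega

theorem b_left_eq_zero {N α : ℕ} (β : ℕ) (hN : N ≠ 0) (hαN : α ≤ N) : b N α β (N - α) = 0 := by
  refine mul_eq_zero_of_left (one_sub_qpow_eq_zero hN (m := N) dvd_rfl ?_) _
  push_cast [Nat.cast_sub hαN]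
  ring

theorem b_right_eq_zero {N β : ℕ} (α : ℕ) (hN : N ≠ 0) (hβN : β ≤ N) :
    b N α β (N - β) = 0 := by
  refine mul_eq_zero_of_right _ (one_sub_qpow_eq_zero hN (m := N) dvd_rfl ?_)
  push_cast [Nat.cast_sub hβN]
  ring

/-! ### Solutions of the recurrence on an interval -/

@[simp]
theorem ratio_self (N α β γ m : ℕ) : ratio N α β γ m m = 1 := by simp [ratio]

theorem a_mul_ratio_succ {N α β γ m k : ℕ} (hmk : m ≤ k) (ha : a N γ (k + 1) ≠ 0) :
    a N γ (k + 1) * ratio N α β γ m (k + 1) = b N α β k * ratio N α β γ m k := by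
  rw [ratio, ratio, Finset.prod_Ico_succ_top hmk, Finset.prod_Icc_succ_top (by omega)]
  rw [← mul_div_assoc, mul_comm, mul_div_mul_right _ _ ha, mul_comm _ (b N α β k), mul_div_assoc]

/-- The quotient `a_{k+1} ⋯ a_n / (b_k ⋯ b_n)`, which solves the recurrence downwards from `n`. -/
def backRatio (N α β γ n k : ℕ) : ℂ :=
  (∏ i ∈ Finset.Icc (k + 1) n, a N γ i) / ∏ i ∈ Finset.Icc k n, b N α β i

theorem a_mul_backRatio_succ {N α β γ n k : ℕ} (hk : k + 1 ≤ n) (hb : b N α β k ≠ 0) :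
    a N γ (k + 1) * backRatio N α β γ n (k + 1) = b N α β k * backRatio N α β γ n k := by
  have h₁ : ∏ i ∈ Finset.Icc (k + 1) n, a N γ i =
      a N γ (k + 1) * ∏ i ∈ Finset.Icc (k + 1 + 1) n, a N γ i := by
    rw [← Finset.insert_Icc_add_one_left_eq_Icc hk, Finset.prod_insert (by simp)]
  have h₂ : ∏ i ∈ Finset.Icc k n, b N α β i =
      b N α β k * ∏ i ∈ Finset.Icc (k + 1) n, b N α β i := by
    rw [← Finset.insert_Icc_add_one_left_eq_Icc (by omega : k ≤ n), Finset.prod_insert (by simp)]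
  rw [backRatio, backRatio, h₁, h₂, ← mul_div_assoc, ← mul_div_assoc, mul_div_mul_left _ _ hb]

theorem b_mul_backRatio_self {N α β γ n : ℕ} (hb : b N α β n ≠ 0) :
    b N α β n * backRatio N α β γ n n = 1 := by
  simp [backRatio, hb]

/-- The sequence that agrees with `F` on `m ≤ k ≤ n` and vanishes elsewhere. -/
def trunc (m n : ℕ) (F : ℕ → ℂ) (k : ℕ) : ℂ := if m ≤ k ∧ k ≤ n then F k else 0

theorem trunc_of_mem {m n k : ℕ} (F : ℕ → ℂ) (h : m ≤ k) (h' : k ≤ n) :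
    trunc m n F k = F k := if_pos ⟨h, h'⟩

theorem trunc_of_lt {m n k : ℕ} (F : ℕ → ℂ) (h : k < m) : trunc m n F k = 0 :=
  if_neg fun h' => by omega

theorem trunc_of_gt {m n k : ℕ} (F : ℕ → ℂ) (h : n < k) : trunc m n F k = 0 :=
  if_neg fun h' => by omega

theorem sum_range_trunc_mul {N m n : ℕ} (F G : ℕ → ℂ) (hn : n < N) :
    ∑ k ∈ Finset.range N, trunc m n F k * G k = ∑ k ∈ Finset.Icc m n, F k * G k := by
  symm
  refine Finset.sum_subset_zero_on_sdiff (fun k hk => ?_) (fun k hk => ?_) (fun k hk => ?_)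
  · rw [Finset.mem_Icc] at hk
    exact Finset.mem_range.2 (by omega)
  · rw [Finset.mem_sdiff, Finset.mem_Icc] at hk
    rw [trunc, if_neg hk.2, zero_mul]
  · rw [Finset.mem_Icc] at hk
    rw [trunc, if_pos hk]

/-- A solution of the recurrence on `m ≤ k ≤ n` may be extended by zero, as `a m = 0` and
`b n = 0`. -/
theorem a_mul_trunc_succ {N α β γ m n : ℕ} {F : ℕ → ℂ} (ham : a N γ m = 0)
    (hbn : n + 1 < N → b N α β n = 0)
    (hF : ∀ k, m ≤ k → k < n → a N γ (k + 1) * F (k + 1) = b N α β k * F k)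
    {k : ℕ} (hk : k + 1 < N) :
    a N γ (k + 1) * trunc m n F (k + 1) = b N α β k * trunc m n F k := by
  rcases lt_trichotomy (k + 1) m with h | h | h
  · rw [trunc_of_lt _ h, trunc_of_lt _ (by omega), mul_zero, mul_zero]
  · rw [h, ham, trunc_of_lt _ (by omega : k < m), zero_mul, mul_zero]
  · rcases lt_trichotomy k n with h' | h' | h'
    · rw [trunc_of_mem _ (by omega) (by omega), trunc_of_mem _ (by omega) (by omega),
        hF k (by omega) h']
    · subst h'
      rw [hbn hk, trunc_of_gt _ (by omega : k < k + 1), zero_mul, mul_zero]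
    · rw [trunc_of_gt _ (by omega : n < k + 1), trunc_of_gt _ h', mul_zero, mul_zero]

/-- The partial sums of the corrections `e_j`, from `j = m + 1` on. -/
def corrSum (N α β γ m k : ℕ) : ℂ := ∑ j ∈ Finset.Icc (m + 1) k, corr N α β γ j

@[simp]
theorem corrSum_self (N α β γ m : ℕ) : corrSum N α β γ m m = 0 := by simp [corrSum]

/-- The corrections `e_j` turn the coefficients of the first solution into those that accompany it
when it is multiplied by `x`. -/
theorem a_mul_ratio_mul_corrSum_succ {N α β γ m k : ℕ} (hmk : m ≤ k) (ha : a N γ (k + 1) ≠ 0)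
    (hb : b N α β k ≠ 0) :
    a N γ (k + 1) * (ratio N α β γ m (k + 1) * corrSum N α β γ m (k + 1)) +
        (a N γ (k + 1) - (1 - qpow N (γ + 2 * (k + 1 : ℕ) - 1))) * ratio N α β γ m (k + 1) =
      b N α β k * (ratio N α β γ m k * corrSum N α β γ m k) +
        (b N α β k - (1 - qpow N (α + β + 2 * k))) * ratio N α β γ m k := by
  have h := a_mul_ratio_succ (α := α) (β := β) hmk ha
  have hs : corrSum N α β γ m (k + 1) = corrSum N α β γ m k + corr N α β γ (k + 1) :=
    Finset.sum_Icc_succ_top (by omega) _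
  have e : a N γ (k + 1) * b N α β k * corr N α β γ (k + 1) =
      b N α β k * (1 - qpow N (γ + 2 * (k + 1 : ℕ) - 1)) -
        a N γ (k + 1) * (1 - qpow N (α + β + 2 * k)) := by
    rw [corr, Nat.add_sub_cancel, show (α + β + 2 * ((k + 1 : ℕ) - 1) : ℂ) = α + β + 2 * k by
      push_cast; ring]
    field_simp
  apply mul_left_cancel₀ hb
  rw [hs]
  linear_combination b N α β k * (corrSum N α β γ m k + 1) * h +
    ratio N α β γ m (k + 1) * e - (1 - qpow N (α + β + 2 * k)) * h

/-- The factor of the part of the second solution between `N - α` and `N - β`. -/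
def jump (N α β γ m : ℕ) : ℂ :=
  (1 - qpow N (β - α)) *
    ((∏ i ∈ Finset.Ico m (N - α), b N α β i) / ∏ i ∈ Finset.Icc (m + 1) (N - α + 1), a N γ i)

theorem a_mul_jump {N α β γ m : ℕ} (hm : m ≤ N - α) (ha : a N γ (N - α + 1) ≠ 0) :
    a N γ (N - α + 1) * jump N α β γ m = (1 - qpow N (β - α)) * ratio N α β γ m (N - α) := by
  rw [jump, ratio, Finset.prod_Icc_succ_top (by omega)]
  rw [mul_left_comm, mul_comm (∏ i ∈ Finset.Icc (m + 1) (N - α), a N γ i), ← mul_div_assoc,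
    mul_div_mul_left _ _ ha]

/-- The coefficients of `x ^ 0` in the second solution from `m` on: the corrected coefficients of
the first one up to `N - α`, and their continuation up to `N - β`. -/
def upper (N α β γ m : ℕ) (k : ℕ) : ℂ :=
  trunc m (N - α) (fun k => ratio N α β γ m k * corrSum N α β γ m k) k -
    trunc (N - α + 1) (N - β) (fun k => jump N α β γ m * ratio N α β γ (N - α + 1) k) k

section
variable {N α β γ m : ℕ}

theorem one_sub_qpow_jump (hN : N ≠ 0) (hαN : α ≤ N) :
    1 - qpow N (α + β + 2 * (N - α : ℕ)) = 1 - qpow N (β - α) := by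
  rw [Nat.cast_sub hαN, show (α + β + 2 * (N - α) : ℂ) = N + (N + (β - α)) by ring, qpow_add,
    qpow_add, qpow_self hN, one_mul, one_mul]

/-- At `k = N - α`, a zero of `b`, the last term of the right-hand side is `-(1 - q ^ (β - α))`
times a coefficient of the first solution, and `jump` compensates it; for `α = β` it vanishes. -/
theorem upper_succ (hN : N ≠ 0) (hα : 1 ≤ α) (hαN : α ≤ N) (hβ : 1 ≤ β) (hβα : β ≤ α)
    (hm : m ≤ N - α) (ha : ∀ i, m < i → i ≤ N - β → a N γ i ≠ 0) {k : ℕ} (hmk : m ≤ k) :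
    a N γ (k + 1) * upper N α β γ m (k + 1) +
        (a N γ (k + 1) - (1 - qpow N (γ + 2 * (k + 1 : ℕ) - 1))) *
          trunc m (N - α) (ratio N α β γ m) (k + 1) =
      b N α β k * upper N α β γ m k + (b N α β k - (1 - qpow N (α + β + 2 * k))) *
          trunc m (N - α) (ratio N α β γ m) k := by
  rcases lt_trichotomy k (N - α) with h | h | h
  · rw [upper, upper, trunc_of_mem _ (by omega) (by omega), trunc_of_lt _ (by omega),
      trunc_of_mem _ (by omega) (by omega), trunc_of_mem _ (by omega) (by omega),
      trunc_of_lt _ (by omega), trunc_of_mem _ (by omega) (by omega), sub_zero, sub_zero]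
    exact a_mul_ratio_mul_corrSum_succ hmk (ha _ (by omega) (by omega))
      (b_ne_zero hα hαN hβ (by omega) (by omega) (by omega) (by omega))
  · subst h
    rw [one_sub_qpow_jump hN hαN, b_left_eq_zero β hN hαN, upper,
      trunc_of_gt _ (by omega : N - α < N - α + 1), trunc_of_gt _ (by omega : N - α < N - α + 1),
      trunc_of_mem _ hmk le_rfl, zero_sub, zero_mul, zero_sub, mul_zero, add_zero, zero_add]
    rcases hβα.eq_or_lt with e | e
    · subst e
      rw [trunc_of_gt _ (by omega), sub_self, qpow_zero, sub_self]
      simp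
    · rw [trunc_of_mem _ le_rfl (by omega), ratio_self, mul_one, mul_neg,
        a_mul_jump hm (ha _ (by omega) (by omega)), neg_mul]
  · rw [trunc_of_gt _ h, trunc_of_gt _ (by omega : N - α < k + 1), mul_zero, mul_zero, add_zero,
      add_zero, upper, upper, trunc_of_gt _ h, trunc_of_gt _ (by omega : N - α < k + 1), zero_sub,
      zero_sub, mul_neg, mul_neg]
    congr 1
    rcases lt_trichotomy k (N - β) with h' | h' | h'
    · rw [trunc_of_mem _ (by omega) (by omega), trunc_of_mem _ (by omega) (by omega),
        mul_left_comm, a_mul_ratio_succ (by omega) (ha _ (by omega) (by omega)), mul_left_comm]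
    · rw [h', b_right_eq_zero α hN (by omega), trunc_of_gt _ (by omega), mul_zero, zero_mul]
    · rw [trunc_of_gt _ (by omega), trunc_of_gt _ (by omega), mul_zero, mul_zero]

/-- The coefficients `upper` need no wrap-around term: at `N - 1` either they vanish or `b` does. -/
theorem upper_last (hN : N ≠ 0) (hα : 1 ≤ α) (hαN : α ≤ N) (hβ : 1 ≤ β) (hβα : β ≤ α)
    (hm : m ≤ N - α) :
    b N α β (N - 1) * upper N α β γ m (N - 1) +
      (b N α β (N - 1) - (1 - qpow N (α + β + 2 * (N - 1 : ℕ)))) *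
        trunc m (N - α) (ratio N α β γ m) (N - 1) = 0 := by
  rcases hα.eq_or_lt with e | e
  · subst e
    obtain rfl : β = 1 := by omega
    rw [one_sub_qpow_jump hN hαN, b_left_eq_zero 1 hN hαN]
    simp
  · rw [trunc_of_gt _ (by omega), mul_zero, add_zero, upper, trunc_of_gt _ (by omega)]
    rcases hβ.eq_or_lt with e' | e'
    · subst e'
      rw [b_right_eq_zero α hN (by omega), zero_mul]
    · rw [trunc_of_gt _ (by omega), sub_zero, mul_zero]

/-- A sequence cut off at a zero of `b` contributes nothing to the wrap-around term. -/
theorem b_last_mul_trunc {n : ℕ} (F : ℕ → ℂ) (hb : b N α β n = 0) (hn : n < N) :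
    b N α β (N - 1) * trunc m n F (N - 1) = 0 := by
  rcases (by omega : n = N - 1 ∨ n < N - 1) with h | h
  · rw [← h, hb, zero_mul]
  · rw [trunc_of_gt _ h, mul_zero]

/-- A solution of the recurrence on an interval bounded by zeros of `a` and `b` gives a solution
of the equation. -/
theorem L_comb_trunc_eq_zero (hN : N ≠ 0) {n : ℕ} {F : ℕ → ℂ} (ham : a N γ m = 0)
    (hbn : b N α β n = 0) (hn : n < N)
    (hF : ∀ k, m ≤ k → k < n → a N γ (k + 1) * F (k + 1) = b N α β k * F k) :
    L N α β γ (comb N (trunc m n F) 0 0) = 0 := by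
  refine L_comb_eq_zero hN (fun k _ => by simp) (fun k hk => ?_) (fun k _ => by simp) (by simp)
    (by simp) ?_
  · simpa using a_mul_trunc_succ ham (fun _ => hbn) hF hk
  · simpa using b_last_mul_trunc F hbn hn

end

/-! ### The explicit solutions -/

section
variable {N α β γ : ℕ}

/-- The second solution for `γ ≤ β`. Wrapping around from `k = N - 1` to `k = 0`, the recurrence is
met by coefficients of `q ^ (-N x)` that run downwards from `N - 1` to the zero of `a`. -/
theorem L_comb_eq_zero_of_gamma_le_beta (hα : 1 ≤ α) (hαN : α ≤ N) (hβ : 1 ≤ β) (hβα : β ≤ α)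
    (hγ : 1 ≤ γ)
    (hγβ : γ ≤ β) :
    L N α β γ (comb N (upper N α β γ 0)
      (trunc (N - γ + 1) (N - 1) fun k => -(1 - qpow N (γ - 1)) * backRatio N α β γ (N - 1) k)
      (trunc 0 (N - α) (ratio N α β γ 0))) = 0 := by
  have hN : N ≠ 0 := by omega
  have ha : ∀ i, 0 < i → i ≤ N - β → a N γ i ≠ 0 := fun i h0 hi =>
    a_ne_zero hγ (by omega) h0 (by omega) (by omega)
  refine L_comb_eq_zero hN (fun k hk => ?_) (fun k _ => ?_) (fun k hk => ?_) ?_ ?_ ?_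
  · refine a_mul_trunc_succ (by simp [a]) (fun _ => b_left_eq_zero β hN hαN) (fun k _ h => ?_) hk
    exact a_mul_ratio_succ (by omega) (ha _ (by omega) (by omega))
  · exact upper_succ hN hα hαN hβ hβα (by omega) ha (by omega)
  · refine a_mul_trunc_succ (a_eq_zero hN (by omega)) (fun h => by omega) (fun k h h' => ?_) hk
    rw [mul_left_comm, a_mul_backRatio_succ (by omega)
      (b_ne_zero hα hαN hβ (by omega) (by omega) (by omega) (by omega)), mul_left_comm]
  · exact b_last_mul_trunc _ (b_left_eq_zero β hN hαN) (by omega)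
  · rw [trunc_of_mem _ le_rfl (by omega), ratio_self, mul_one]
    rcases hγ.eq_or_lt with e | e
    · subst e
      rw [trunc_of_lt _ (by omega)]
      simp
    · rw [trunc_of_mem _ (by omega) le_rfl, mul_left_comm, b_mul_backRatio_self
        (b_ne_zero hα hαN hβ (by omega) (by omega) (by omega) (by omega)), mul_one]
  · exact upper_last hN hα hαN hβ hβα (by omega)

/-- The second solution for `α < γ`. As the first one starts at `N - γ + 1`, a zero of `a`, the
recurrence is met there by coefficients that run downwards from `N - γ` to `0`, the other zero
of `a`. -/
theorem L_comb_eq_zero_of_alpha_lt_gamma (hα : 1 ≤ α) (hβ : 1 ≤ β) (hβα : β ≤ α)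
    (hαγ : α < γ) (hγN : γ ≤ N) :
    L N α β γ (comb N
      (fun k => upper N α β γ (N - γ + 1) k + trunc 0 (N - γ)
        (fun k => -(1 - qpow N (N - γ + 1)) * backRatio N α β γ (N - γ) k) k)
      0 (trunc (N - γ + 1) (N - α) (ratio N α β γ (N - γ + 1)))) = 0 := by
  have hN : N ≠ 0 := by omega
  have ha : ∀ i, N - γ + 1 < i → i ≤ N - β → a N γ i ≠ 0 := fun i h0 hi =>
    a_ne_zero (by omega) hγN (by omega) (by omega) (by omega)
  have hb : ∀ i, i ≤ N - γ → b N α β i ≠ 0 := fun i hi =>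
    b_ne_zero hα (by omega) hβ (by omega) (by omega) (by omega) (by omega)
  have hup : ∀ k, k ≤ N - γ + 1 → upper N α β γ (N - γ + 1) k = 0 := fun k hk => by
    rw [upper, trunc_of_lt _ (by omega : k < N - α + 1), sub_zero]
    rcases hk.eq_or_lt with rfl | h
    · rw [trunc_of_mem _ le_rfl (by omega), corrSum_self, mul_zero]
    · rw [trunc_of_lt _ h]
  refine L_comb_eq_zero hN (fun k hk => ?_) (fun k _ => ?_) (fun k _ => by simp) ?_ ?_ ?_
  · refine a_mul_trunc_succ (a_eq_zero hN hγN) (fun _ => b_left_eq_zero β hN (by omega))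
      (fun k _ h => ?_) hk
    exact a_mul_ratio_succ (by omega) (ha _ (by omega) (by omega))
  · rcases lt_trichotomy k (N - γ) with h | h | h
    · rw [hup _ (by omega), hup _ (by omega), trunc_of_mem (m := 0) _ (by omega) (by omega),
        trunc_of_mem (m := 0) _ (by omega) (by omega),
        trunc_of_lt (m := N - γ + 1) _ (by omega), trunc_of_lt (m := N - γ + 1) _ (by omega),
        mul_zero, mul_zero, add_zero, add_zero, zero_add, zero_add, mul_left_comm,
        a_mul_backRatio_succ (by omega) (hb _ (by omega)), mul_left_comm]
    · subst h
      -- `q ^ (γ + 2 (N - γ + 1) - 1) = q ^ (N - γ + 1)`, up to the period `q ^ N = 1`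
      have e : qpow N (γ + 2 * (N - γ + 1 : ℕ) - 1) = qpow N (N - γ + 1) := by
        rw [Nat.cast_succ, Nat.cast_sub hγN,
          show (γ + 2 * (N - γ + 1) - 1 : ℂ) = N + (N - γ + 1) by ring, qpow_add, qpow_self hN,
          one_mul]
      rw [e, a_eq_zero hN hγN, hup (N - γ) (by omega), trunc_of_mem _ le_rfl (by omega),
        ratio_self, trunc_of_lt (m := N - γ + 1) _ (by omega), trunc_of_mem _ (by omega) le_rfl,
        zero_mul, mul_zero, add_zero, zero_add, zero_add, mul_left_comm,
        b_mul_backRatio_self (hb _ le_rfl),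
        zero_sub]
    · rw [trunc_of_gt (n := N - γ) _ h, trunc_of_gt (n := N - γ) _ (by omega), add_zero, add_zero]
      exact upper_succ hN hα (by omega) hβ hβα (by omega) ha (by omega)
  · exact b_last_mul_trunc _ (b_left_eq_zero β hN (by omega)) (by omega)
  · rw [trunc_of_lt _ (by omega)]
    simp
  · rw [trunc_of_gt (n := N - γ) _ (by omega), add_zero]
    exact upper_last hN hα (by omega) hβ hβα (by omega)

theorem coe_comb_trunc {m n : ℕ} (F : ℕ → ℂ) (hn : n < N) :
    (comb N (trunc m n F) 0 0 : Germ (codiscrete ℂ) ℂ) =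
      ((fun x => ∑ k ∈ Finset.Icc m n, F k * qpow N (k * x) : ℂ → ℂ) :
        Germ (codiscrete ℂ) ℂ) := by
  rw [coe_comb]
  refine congrArg (fun f : ℂ → ℂ => (f : Germ (codiscrete ℂ) ℂ)) (funext fun x => ?_)
  simpa using sum_range_trunc_mul F (fun k => qpow N (k * x)) hn

/-- In the sum of the corrected coefficients the term `k = m` drops out, as its correction is an
empty sum. -/
theorem sum_upper_mul {m : ℕ} (hα : 1 ≤ α) (hαN : α ≤ N) (hβ : 1 ≤ β) (hβα : β ≤ α)
    (hm : m ≤ N - α) (G : ℕ → ℂ) :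
    ∑ k ∈ Finset.range N, upper N α β γ m k * G k =
      ∑ k ∈ Finset.Icc (m + 1) (N - α),
        ratio N α β γ m k * (∑ j ∈ Finset.Icc (m + 1) k, corr N α β γ j) * G k -
      (1 - qpow N (β - α)) *
        ((∏ i ∈ Finset.Ico m (N - α), b N α β i) /
          ∏ i ∈ Finset.Icc (m + 1) (N - α + 1), a N γ i) *
        ∑ k ∈ Finset.Icc (N - α + 1) (N - β), ratio N α β γ (N - α + 1) k * G k := by
  simp only [upper, sub_mul _ _ (G _), Finset.sum_sub_distrib]
  rw [sum_range_trunc_mul _ _ (by omega), sum_range_trunc_mul _ _ (by omega),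
    ← Finset.insert_Icc_add_one_left_eq_Icc hm, Finset.sum_insert (by simp), corrSum_self,
    mul_zero, zero_mul, zero_add, Finset.mul_sum]
  simp only [mul_assoc, jump, corrSum]

theorem coe_comb_eq_psi₂A (hα : 1 ≤ α) (hαN : α ≤ N) (hβ : 1 ≤ β) (hβα : β ≤ α) :
    (comb N (upper N α β γ 0)
      (trunc (N - γ + 1) (N - 1) fun k => -(1 - qpow N (γ - 1)) * backRatio N α β γ (N - 1) k)
      (trunc 0 (N - α) (ratio N α β γ 0)) : Germ (codiscrete ℂ) ℂ) = psi₂A N α β γ := by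
  rw [coe_comb]
  refine congrArg (fun f : ℂ → ℂ => (f : Germ (codiscrete ℂ) ℂ)) (funext fun x => ?_)
  simp only [add_mul, Finset.sum_add_distrib, mul_assoc]
  rw [sum_upper_mul hα hαN hβ hβα (by omega), sum_range_trunc_mul _ _ (by omega),
    sum_range_trunc_mul _ _ (by omega), psi₂A, psi₁]
  have e1 : ∑ k ∈ Finset.Icc 0 (N - α), ratio N α β γ 0 k * (x * qpow N (k * x)) =
      x * ∑ k ∈ Finset.Icc 0 (N - α), ratio N α β γ 0 k * qpow N (k * x) := by
    rw [Finset.mul_sum]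
    exact Finset.sum_congr rfl fun k _ => mul_left_comm _ _ _
  have e2 : ∑ k ∈ Finset.Icc (N - γ + 1) (N - 1),
      -(1 - qpow N (γ - 1)) * backRatio N α β γ (N - 1) k *
        ((qpow N (N * x))⁻¹ * qpow N (k * x)) =
      -((1 - qpow N (γ - 1)) * ∑ k ∈ Finset.Icc (N - γ + 1) (N - 1),
          (∏ i ∈ Finset.Icc (k + 1) (N - 1), a N γ i) /
            ((∏ i ∈ Finset.Icc k (N - 1), b N α β i) * qpow N (N * x)) * qpow N (k * x)) := by
    rw [Finset.mul_sum, ← Finset.sum_neg_distrib]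
    refine Finset.sum_congr rfl fun k _ => ?_
    rw [backRatio, ← div_div]
    ring
  rw [e1, e2]
  ring

theorem coe_comb_eq_psi₂C (hα : 1 ≤ α) (hβ : 1 ≤ β) (hβα : β ≤ α) (hαγ : α < γ) (hγN : γ ≤ N) :
    (comb N
      (fun k => upper N α β γ (N - γ + 1) k + trunc 0 (N - γ)
        (fun k => -(1 - qpow N (N - γ + 1)) * backRatio N α β γ (N - γ) k) k)
      0 (trunc (N - γ + 1) (N - α) (ratio N α β γ (N - γ + 1))) : Germ (codiscrete ℂ) ℂ) =
      psi₂C N α β γ := by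
  rw [coe_comb]
  refine congrArg (fun f : ℂ → ℂ => (f : Germ (codiscrete ℂ) ℂ)) (funext fun x => ?_)
  simp only [add_mul, Finset.sum_add_distrib, mul_assoc, Pi.zero_apply, zero_mul,
    add_zero]
  rw [sum_upper_mul hα (by omega) hβ hβα (by omega), sum_range_trunc_mul _ _ (by omega),
    sum_range_trunc_mul _ _ (by omega), psi₂C, psi₁C]
  have e1 : ∑ k ∈ Finset.Icc (N - γ + 1) (N - α),
        ratio N α β γ (N - γ + 1) k * (x * qpow N (k * x)) =
      x * ∑ k ∈ Finset.Icc (N - γ + 1) (N - α),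
        ratio N α β γ (N - γ + 1) k * qpow N (k * x) := by
    rw [Finset.mul_sum]
    exact Finset.sum_congr rfl fun k _ => mul_left_comm _ _ _
  have e2 : ∑ k ∈ Finset.Icc 0 (N - γ),
      -(1 - qpow N (N - γ + 1)) * backRatio N α β γ (N - γ) k * qpow N (k * x) =
      -((1 - qpow N (N - γ + 1)) * ∑ k ∈ Finset.Icc 0 (N - γ),
          (∏ i ∈ Finset.Icc (k + 1) (N - γ), a N γ i) /
            (∏ i ∈ Finset.Icc k (N - γ), b N α β i) * qpow N (k * x)) := by
    rw [Finset.mul_sum, ← Finset.sum_neg_distrib]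
    refine Finset.sum_congr rfl fun k _ => ?_
    rw [backRatio]
    ring
  rw [e1, e2]
  ring

/-- Two solutions of degree at most one in `x` that are independent span all solutions, and hence
bound the powers of `x` that occur in a solution. -/
theorem basis_and_degree (hN : 2 ≤ N) {c₁ d₁ v₁ c₂ d₂ v₂ : ℕ → ℂ}
    (h₁ : L N α β γ (comb N c₁ d₁ v₁) = 0) (h₂ : L N α β γ (comb N c₂ d₂ v₂) = 0)
    (h : LinearIndependent QC ![comb N c₁ d₁ v₁, comb N c₂ d₂ v₂]) {Ψ₁ Ψ₂ : ℂ → ℂ}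
    (e₁ : (comb N c₁ d₁ v₁ : Germ (codiscrete ℂ) ℂ) = Ψ₁)
    (e₂ : (comb N c₂ d₂ v₂ : Germ (codiscrete ℂ) ℂ) = Ψ₂) :
    IsSolBasis N α β γ Ψ₁ Ψ₂ ∧
    ∀ (n : ℕ) (f : ℕ → Fin N → QC),
      L N α β γ (∑ j ∈ Finset.range (n + 1), ∑ k : Fin N, f j k • (X ^ j * qX N k)) = 0 →
      ∀ j, 2 ≤ j → j ≤ n → ∀ k, f j k = 0 := by
  have hN' : N ≠ 0 := by omega
  obtain ⟨B, hB₁, hB₂⟩ := exists_basis_of_linearIndependent hN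
    ⟨comb_mem_S hN' c₁ d₁ v₁, h₁⟩ ⟨comb_mem_S hN' c₂ d₂ v₂, h₂⟩ h
  refine ⟨⟨B, by rw [hB₁, e₁], by rw [hB₂, e₂]⟩, fun n f hf j hj hjn k => ?_⟩
  have hmem := mem_span_pair_of_recurrence (leadingCoeff_ne_zero hN α β γ) h
    ((L_apply N α β γ _).symm.trans h₁) ((L_apply N α β γ _).symm.trans h₂)
    ((L_apply N α β γ _).symm.trans hf)
  obtain ⟨s, t, hst⟩ := Submodule.mem_span_pair.1 hmem
  exact coeff_eq_zero_of_mem_span_comb hN' hst.symm hj hjn k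

/-- A function without `x` and one with `x` are independent, if a coefficient `1` shows that
neither the former nor the part with `x` of the latter vanishes. -/
theorem linearIndependent_comb_of_linear {c₁ c₂ d₂ v₂ : ℕ → ℂ} {m : ℕ} (hm : m < N)
    (hc : c₁ m = 1) (hv : v₂ m = 1) :
    LinearIndependent QC ![comb N c₁ 0 0, comb N c₂ d₂ v₂] := by
  have hN : N ≠ 0 := by omega
  rw [LinearIndependent.pair_iff]
  intro s t h
  obtain ⟨h0, h1⟩ := coeff_eq_zero_of_smul_comb_add hN h hm
  have ht : t = 0 := Subtype.ext (by simpa [hv] using h1)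
  rw [ht, zero_mul, add_zero, combCoeff_self hN hc rfl] at h0
  exact ⟨Subtype.ext (by simpa using congrArg Subtype.val h0), ht⟩

/-- Two functions without `x` are independent, if a coefficient `1` of each is a coefficient `0`
of the other. -/
theorem linearIndependent_comb_of_disjoint {c₁ c₂ : ℕ → ℂ} {m n : ℕ} (hm : m < N) (hn : n < N)
    (h₁m : c₁ m = 1) (h₂m : c₂ m = 0) (h₁n : c₁ n = 0) (h₂n : c₂ n = 1) :
    LinearIndependent QC ![comb N c₁ 0 0, comb N c₂ 0 0] := by
  have hN : N ≠ 0 := by omega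
  rw [LinearIndependent.pair_iff]
  intro s t h
  have hs := (coeff_eq_zero_of_smul_comb_add hN h hm).1
  have ht := (coeff_eq_zero_of_smul_comb_add hN h hn).1
  rw [combCoeff_self hN h₁m rfl, combCoeff_self hN h₂m rfl] at hs
  rw [combCoeff_self hN h₁n rfl, combCoeff_self hN h₂n rfl] at ht
  exact ⟨Subtype.ext (by simpa using congrArg Subtype.val hs),
    Subtype.ext (by simpa using congrArg Subtype.val ht)⟩

end

end QHyp

end

open QHyp in
theorem mainTheorem1 (N α β γ : ℕ) (hN : 2 ≤ N)
    (hα : α ∈ Finset.Icc 1 N) (hβ : β ∈ Finset.Icc 1 N) (hγ : γ ∈ Finset.Icc 1 N)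
    (hβα : β ≤ α) :
    -- the space of solutions is two-dimensional over the quasi-constants
    Module.finrank QHyp.QC (QHyp.Sol N α β γ) = 2 ∧
    -- a solution involves no power `x ^ j` with `j ≥ 2`
    (∀ (n : ℕ) (f : ℕ → Fin N → QHyp.QC),
      QHyp.L N α β γ (∑ j ∈ Finset.range (n + 1), ∑ k : Fin N,
        f j k • (QHyp.X ^ j * QHyp.qX N k)) = 0 →
      ∀ j, 2 ≤ j → j ≤ n → ∀ k, f j k = 0) ∧
    -- the explicit bases
    (γ ≤ β → QHyp.IsSolBasis N α β γ (QHyp.psi₁ N α β γ) (QHyp.psi₂A N α β γ)) ∧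
    (β < γ → γ ≤ α → QHyp.IsSolBasis N α β γ (QHyp.psi₁ N α β γ) (QHyp.psi₂B N α β γ)) ∧
    (α < γ → QHyp.IsSolBasis N α β γ (QHyp.psi₁C N α β γ) (QHyp.psi₂C N α β γ)) := by
  obtain ⟨hα, hαN⟩ := Finset.mem_Icc.1 hα
  obtain ⟨hβ, hβN⟩ := Finset.mem_Icc.1 hβ
  obtain ⟨hγ, hγN⟩ := Finset.mem_Icc.1 hγ
  have hN' : N ≠ 0 := by omega
  have hfin : ∀ {Ψ₁ Ψ₂ : ℂ → ℂ}, IsSolBasis N α β γ Ψ₁ Ψ₂ →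
      Module.finrank QC (Sol N α β γ) = 2 := by
    rintro _ _ ⟨B, -⟩
    rw [Module.finrank_eq_card_basis B, Fintype.card_fin]
  have h₁ : γ ≤ α → L N α β γ (comb N (trunc 0 (N - α) (ratio N α β γ 0)) 0 0) = 0 := fun h =>
    L_comb_trunc_eq_zero hN' (by simp [a]) (b_left_eq_zero β hN' hαN) (by omega) fun k _ hk =>
      a_mul_ratio_succ (by omega) (a_ne_zero hγ hγN (by omega) (by omega) (by omega))
  have hm : ∀ n < N, b N α β n = 0 →
      L N α β γ (comb N (trunc (N - γ + 1) n (ratio N α β γ (N - γ + 1))) 0 0) = 0 :=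
    fun n hn hb => L_comb_trunc_eq_zero hN' (a_eq_zero hN' hγN) hb hn fun k _ hk =>
      a_mul_ratio_succ (by omega) (a_ne_zero hγ hγN (by omega) (by omega) (by omega))
  have hself : ∀ m n, m ≤ n → trunc m n (ratio N α β γ m) m = 1 := fun m n h => by
    rw [trunc_of_mem _ le_rfl h, ratio_self]
  have hA : γ ≤ β → _ := fun h => basis_and_degree hN (h₁ (by omega))
    (L_comb_eq_zero_of_gamma_le_beta hα hαN hβ hβα hγ h)
    (linearIndependent_comb_of_linear (m := 0) (by omega) (hself _ _ (by omega))
      (hself _ _ (by omega)))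
    (coe_comb_trunc _ (by omega)) (coe_comb_eq_psi₂A hα hαN hβ hβα)
  have hB : β < γ → γ ≤ α → _ := fun h h' => basis_and_degree hN (h₁ h')
    (hm (N - β) (by omega) (b_right_eq_zero α hN' hβN))
    (linearIndependent_comb_of_disjoint (m := 0) (n := N - γ + 1) (by omega) (by omega)
      (hself _ _ (by omega)) (trunc_of_lt _ (by omega)) (trunc_of_gt _ (by omega))
      (hself _ _ (by omega)))
    (coe_comb_trunc _ (by omega)) (coe_comb_trunc _ (by omega))
  have hC : α < γ → _ := fun h => basis_and_degree hN
    (hm (N - α) (by omega) (b_left_eq_zero β hN' hαN))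
    (L_comb_eq_zero_of_alpha_lt_gamma hα hβ hβα h hγN)
    (linearIndependent_comb_of_linear (m := N - γ + 1) (by omega) (hself _ _ (by omega))
      (hself _ _ (by omega)))
    (coe_comb_trunc _ (by omega)) (coe_comb_eq_psi₂C hα hβ hβα h hγN)
  refine ⟨?_, ?_, fun h => (hA h).1, fun h h' => (hB h h').1, fun h => (hC h).1⟩
  · rcases le_or_gt γ β with h | h
    · exact hfin (hA h).1
    · rcases le_or_gt γ α with h' | h'
      · exact hfin (hB h h').1
      · exact hfin (hC h').1
  · rcases le_or_gt γ β with h | h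
    · exact (hA h).2
    · rcases le_or_gt γ α with h' | h'
      · exact (hB h h').2
      · exact (hC h').2
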